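/- Let $\mathbb{D}$ be the open unit disk in $\mathbb{C}$, and let $\alpha\ge 0$. For $z\in\mathbb{D}$ put $$T_\alpha=-\frac{\alpha^2}{4}(1-|z|^2)^{-\alpha-1}+\frac{\alpha}{2}(1-|z|^2)^{-\alpha-1}\left(z\frac{\partial}{\partial z}+\overline{z}\frac{\partial}{\partial\overline{z}}\right)+\frac14(1-|z|^2)^{-\alpha}\Delta,$$ where $\Delta=\partial^2/\partial x^2+\partial^2/\partial y^2$, and let $$K_\alpha(z)=\frac{\Gamma(\alpha/2+1)^2}{\Gamma(1+\alpha)}\,\frac{(1-|z|^2)^{\alpha+1}}{|1-z|^{\alpha+2}},\qquad \mathcal{M}_\alpha(r)=\frac{1}{2\pi}\int_0^{2\pi}K_\alpha(re^{it})\,dt\quad(0\le r<1).$$ Let $f\in\mathcal{C}^2(\overline{\mathbb{D}})$ be complex-valued with $T_\alpha f=0$ in $\mathbb{D}$, $f(0)=0$, $f(\overline{\mathbb{D}})=\overline{\mathbb{D}}$ and $f(\partial\mathbb{D})=\partial\mathbb{D}$. Let $D_f$ be the real differential (Jacobian matrix) of $f$, extended continuously to $\overline{\mathbb{D}}$, and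 $\|D_f\|=\sup_{|w|=1}|D_f w|=|f_z|+|f_{\overline z}|$ its operator norm. (a) If $\alpha=0$, then for every real $\theta$, $$\|D_f(e^{i\theta})\|\ge\frac{2}{\pi}.$$ (b) If $\alpha>0$, then $\mathcal{M}_\alpha$ is differentiable on $(0,1)$, $\lim_{r\to1^-}\mathcal{M}_\alpha'(r)$ exists, and for every real $\theta$, $$\|D_f(e^{i\theta})\|\ge\lim_{r\to1^-}\mathcal{M}_\alpha'(r)=\frac{\alpha}{2}.$$ The differentiability of $\mathcal{M}_\alpha$ and the value of the limit hold for every $\alpha>0$, independently of $f$. -/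

import Mathlib

open Set Filter Topology Metric

noncomputable section

namespace HeinzType

/-- The Wirtinger derivative `∂f/∂z = (f_x - i f_y) / 2`. -/
def dz (f : ℂ → ℂ) (z : ℂ) : ℂ :=
  (1 / 2 : ℂ) * (fderiv ℝ f z 1 - Complex.I * fderiv ℝ f z Complex.I)

/-- The Wirtinger derivative `∂f/∂z̄ = (f_x + i f_y) / 2`. -/
def dzbar (f : ℂ → ℂ) (z : ℂ) : ℂ :=
  (1 / 2 : ℂ) * (fderiv ℝ f z 1 + Complex.I * fderiv ℝ f z Complex.I)

/-- The second order operator `T_α`, meant at points `z` of the open unit disk. -/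
def T (α : ℝ) (f : ℂ → ℂ) (z : ℂ) : ℂ :=
  -(((α ^ 2 / 4) * (1 - ‖z‖ ^ 2) ^ (-α - 1) : ℝ) : ℂ) * f z
    + (((α / 2) * (1 - ‖z‖ ^ 2) ^ (-α - 1) : ℝ) : ℂ)
        * (z * dz f z + (starRingEnd ℂ) z * dzbar f z)
    + (((1 / 4) * (1 - ‖z‖ ^ 2) ^ (-α) : ℝ) : ℂ) * Laplacian.laplacian f z

/-- The normalizing constant `c_α = Γ(α/2 + 1)² / Γ(1 + α)`. -/
def c (α : ℝ) : ℝ := Real.Gamma (α / 2 + 1) ^ 2 / Real.Gamma (1 + α)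

/-- The Poisson type kernel `K_α`. -/
def K (α : ℝ) (z : ℂ) : ℝ :=
  c α * ((1 - ‖z‖ ^ 2) ^ (α + 1) / ‖1 - z‖ ^ (α + 2))

/-- The integral mean of `K_α` over the circle of radius `r`. -/
def M (α : ℝ) (r : ℝ) : ℝ :=
  (1 / (2 * Real.pi)) *
    ∫ t in (0 : ℝ)..(2 * Real.pi), K α ((r : ℂ) * Complex.exp ((t : ℂ) * Complex.I))

/-- The real differential of `f` on the closed unit disk. At interior points it is the usual
differential; at boundary points it is the one-sided differential, that is the continuous
extension of the interior one when `f` is continuously differentiable up to the boundary.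
Its operator norm `‖D f z‖` is `sup {|D f z w| : |w| = 1}`. -/
def D (f : ℂ → ℂ) (z : ℂ) : ℂ →L[ℝ] ℂ :=
  fderivWithin ℝ f (closedBall (0 : ℂ) 1) z

end HeinzType

end

/-!
For `α > 0` the lower bound for `‖D f‖` is an identity in disguise. Multiplied by
`4 (1 - |z|²)^(α+1)`, the equation `T_α f = 0` reads
`(1 - |z|²) Δf + 2α ∂_r f = α² f`, with `∂_r = z ∂/∂z + z̄ ∂/∂z̄`. As `f` is `C²` up to the boundary,
the second order term dies there, so `∂_r f = (α/2) f` on the unit circle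
(`D_apply_self_of_T_eq_zero`), where `|f| = 1`.

For `α = 0` the function is harmonic and the Schwarz lemma
`|f(z)| ≤ (4/π) arctan |z|` holds (`norm_le_arctan_norm_of_harmonicOnNhd`). Both sides equal `1` on
the unit circle, so the slope `2/π` of `(4/π) arctan` at `1` bounds the radial derivative of `f` from
below. The Schwarz lemma comes from the holomorphic one: if `u = Re F` is harmonic with `|u| ≤ 1`
and `F(0) = 0`, then `tan (π F / 4)` maps the disk into the closed unit disk, and
`|tan (π u / 4)| ≤ |tan (π F / 4)|`.

For the means `M α`, the boundary change of variables given by the disk automorphism exchanging `0`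
and `r` shows that `M α r` is `c α` times the mean of `|1 - r e^{it}|^α`
(`M_eq_integral_chordSq_rpow`): no singularity of negative order is left. The `r`-derivative of this
integrand is at most `α |1 - r e^{it}|^(α-1)`, hence bounded by a multiple of `t^(α-1) + 1`
uniformly in `r`, and at `r = 1` it equals `α/2` times the integrand. So `M α` may be differentiated
under the integral sign, and by dominated convergence its derivative tends to `α/2` times `c α` times
the mean of `|1 - e^{it}|^α`. The last product is `1` by the beta integral and Legendre's
duplication formula (`c_div_pi_mul_integral_chordSq_one`).
-/

/-! ### Schwarz lemma for harmonic functions -/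

/-- `|sin w|²` exceeds `sin² (Re w)` by `sinh² (Im w)`, exactly as `|cos w|²` exceeds
`cos² (Re w)`. -/
theorem Complex.normSq_sin_eq (w : ℂ) :
    Complex.normSq (Complex.sin w) = Real.sin w.re ^ 2 + Real.sinh w.im ^ 2 := by
  rw [Complex.sin_eq w, Complex.normSq_apply]
  simp only [← Complex.ofReal_sin, ← Complex.ofReal_cos, ← Complex.ofReal_sinh,
    ← Complex.ofReal_cosh, ← Complex.ofReal_mul, Complex.add_re, Complex.add_im,
    Complex.re_ofReal_mul, Complex.im_ofReal_mul, Complex.ofReal_re, Complex.ofReal_im,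
    Complex.I_re, Complex.I_im]
  linear_combination Real.sin w.re ^ 2 * Real.cosh_sq w.im +
    Real.sinh w.im ^ 2 * Real.sin_sq_add_cos_sq w.re

theorem Complex.normSq_cos_eq (w : ℂ) :
    Complex.normSq (Complex.cos w) = Real.cos w.re ^ 2 + Real.sinh w.im ^ 2 := by
  rw [Complex.cos_eq w, Complex.normSq_apply]
  simp only [← Complex.ofReal_sin, ← Complex.ofReal_cos, ← Complex.ofReal_sinh,
    ← Complex.ofReal_cosh, ← Complex.ofReal_mul, Complex.sub_re, Complex.sub_im,
    Complex.re_ofReal_mul, Complex.im_ofReal_mul, Complex.ofReal_re, Complex.ofReal_im,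
    Complex.I_re, Complex.I_im]
  linear_combination Real.cos w.re ^ 2 * Real.cosh_sq w.im +
    Real.sinh w.im ^ 2 * Real.sin_sq_add_cos_sq w.re

theorem Real.cos_pos_of_abs_le_pi_div_four {x : ℝ} (hx : |x| ≤ Real.pi / 4) : 0 < Real.cos x := by
  have := abs_le.1 hx
  exact Real.cos_pos_of_mem_Ioo ⟨by linarith [Real.pi_pos], by linarith [Real.pi_pos]⟩

theorem Real.sin_sq_le_cos_sq_of_abs_le_pi_div_four {x : ℝ} (hx : |x| ≤ Real.pi / 4) :
    Real.sin x ^ 2 ≤ Real.cos x ^ 2 := by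
  have h := abs_le.1 hx
  have : 0 ≤ Real.cos (2 * x) :=
    Real.cos_nonneg_of_mem_Icc ⟨by linarith [Real.pi_pos], by linarith [Real.pi_pos]⟩
  rw [Real.cos_two_mul'] at this
  linarith

theorem Complex.cos_ne_zero_of_abs_re_le {w : ℂ} (hw : |w.re| ≤ Real.pi / 4) :
    Complex.cos w ≠ 0 := by
  have h := Real.cos_pos_of_abs_le_pi_div_four hw
  rw [← Complex.normSq_pos, Complex.normSq_cos_eq]
  positivity

/-- `tan` maps the closed strip `|Re w| ≤ π/4` into the closed unit disk. -/
theorem Complex.norm_tan_le_one_of_abs_re_le {w : ℂ} (hw : |w.re| ≤ Real.pi / 4) :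
    ‖Complex.tan w‖ ≤ 1 := by
  rw [Complex.tan_eq_sin_div_cos, norm_div]
  refine div_le_one_of_le₀ ?_ (norm_nonneg _)
  rw [Complex.norm_def, Complex.norm_def]
  refine Real.sqrt_le_sqrt ?_
  rw [Complex.normSq_sin_eq, Complex.normSq_cos_eq]
  linarith [Real.sin_sq_le_cos_sq_of_abs_le_pi_div_four hw]

theorem Complex.abs_tan_re_le_norm_tan {w : ℂ} (hw : |w.re| ≤ Real.pi / 4) :
    |Real.tan w.re| ≤ ‖Complex.tan w‖ := by
  have hc := Real.cos_pos_of_abs_le_pi_div_four hw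
  have h := Real.sin_sq_le_cos_sq_of_abs_le_pi_div_four hw
  refine abs_le_of_sq_le_sq ?_ (norm_nonneg _)
  rw [Complex.tan_eq_sin_div_cos, norm_div, div_pow, Complex.sq_norm, Complex.sq_norm,
    Complex.normSq_sin_eq, Complex.normSq_cos_eq, Real.tan_eq_sin_div_cos, div_pow,
    div_le_div_iff₀ (by positivity) (by positivity)]
  nlinarith [sq_nonneg (Real.sinh w.im)]

/-- **Schwarz lemma for real harmonic functions.** With `u = Re F`, `F` holomorphic, apply the
Schwarz lemma to `tan (π F / 4)`, which maps the disk into the closed unit disk. -/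
theorem le_arctan_norm_of_harmonicOnNhd {u : ℂ → ℝ}
    (hu : InnerProductSpace.HarmonicOnNhd u (ball 0 1))
    (hb : ∀ z ∈ ball (0 : ℂ) 1, |u z| ≤ 1) (h0 : u 0 = 0) {z : ℂ} (hz : z ∈ ball (0 : ℂ) 1) :
    u z ≤ 4 / Real.pi * Real.arctan ‖z‖ := by
  obtain ⟨F₀, hF₀, hre₀⟩ := hu.exists_analyticOnNhd_ball_re_eq
  -- Remove the imaginary constant, so that the holomorphic function vanishes at the origin.
  set F : ℂ → ℂ := fun z => ((Real.pi / 4 : ℝ) : ℂ) * (F₀ z - F₀ 0) with hFdef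
  have h00 : (0 : ℂ) ∈ ball (0 : ℂ) 1 := by simp
  have hre : ∀ z ∈ ball (0 : ℂ) 1, (F z).re = Real.pi / 4 * u z := by
    intro z hz
    have h1 : (F₀ z).re = u z := hre₀ hz
    have h2 : (F₀ 0).re = u 0 := hre₀ h00
    rw [hFdef, Complex.re_ofReal_mul, Complex.sub_re, h1, h2, h0, sub_zero]
  have hstrip : ∀ z ∈ ball (0 : ℂ) 1, |(F z).re| ≤ Real.pi / 4 := by
    intro z hz
    rw [hre z hz, abs_mul, abs_of_pos (by positivity)]
    exact mul_le_of_le_one_right (by positivity) (hb z hz)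
  have hd : DifferentiableOn ℂ (fun z => Complex.tan (F z)) (ball 0 1) := by
    intro z hz
    have h1 : DifferentiableAt ℂ F z :=
      ((hF₀ z hz).differentiableAt.sub_const _).const_mul _
    exact ((Complex.differentiableAt_tan.2
      (Complex.cos_ne_zero_of_abs_re_le (hstrip z hz))).comp z h1).differentiableWithinAt
  have hS : ‖Complex.tan (F z)‖ ≤ ‖z‖ := by
    refine Complex.norm_le_norm_of_mapsTo_ball (f := fun z => Complex.tan (F z)) hd ?_ ?_
      (mem_ball_zero_iff.1 hz)
    · intro w hw
      exact mem_closedBall_zero_iff.2 (Complex.norm_tan_le_one_of_abs_re_le (hstrip w hw))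
    · simp [hFdef]
  have ht : Real.tan (Real.pi / 4 * u z) ≤ ‖z‖ := by
    rw [← hre z hz]
    exact (le_abs_self _).trans ((Complex.abs_tan_re_le_norm_tan (hstrip z hz)).trans hS)
  have hs := abs_le.1 (hstrip z hz)
  rw [hre z hz] at hs
  have := Real.arctan_mono ht
  rw [Real.arctan_tan (by linarith [Real.pi_pos]) (by linarith [Real.pi_pos])] at this
  calc u z = 4 / Real.pi * (Real.pi / 4 * u z) := by field_simp
    _ ≤ _ := by gcongr

/-- Schwarz lemma for complex-valued harmonic functions: rotate the value `f z` onto the positive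
real axis and take real parts. -/
theorem norm_le_arctan_norm_of_harmonicOnNhd {f : ℂ → ℂ}
    (hf : InnerProductSpace.HarmonicOnNhd f (ball 0 1))
    (hb : ∀ z ∈ ball (0 : ℂ) 1, ‖f z‖ ≤ 1) (h0 : f 0 = 0) {z : ℂ} (hz : z ∈ ball (0 : ℂ) 1) :
    ‖f z‖ ≤ 4 / Real.pi * Real.arctan ‖z‖ := by
  obtain ⟨a, ha, haf⟩ : ∃ a : ℂ, ‖a‖ ≤ 1 ∧ a * f z = ‖f z‖ := by
    by_cases h : f z = 0
    · exact ⟨0, by simp, by simp [h]⟩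
    · refine ⟨‖f z‖ / f z, by simp [h], div_mul_cancel₀ _ h⟩
  set l : ℂ →L[ℝ] ℝ := Complex.reCLM.comp (ContinuousLinearMap.mul ℝ ℂ a) with hl
  have hlapp : ∀ w, l w = (a * w).re := fun w => rfl
  have := le_arctan_norm_of_harmonicOnNhd (hf.comp_CLM l) (fun w hw => ?_) (by simp [h0]) hz
  · simpa only [Function.comp_apply, hlapp, haf, Complex.ofReal_re] using this
  · rw [Function.comp_apply, hlapp]
    refine (Complex.abs_re_le_norm _).trans ?_
    rw [norm_mul]
    exact mul_le_one₀ ha (norm_nonneg _) (hb w hw)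

/-! ### Boundary values of the differential -/

namespace HeinzType

theorem uniqueDiffOn_closedBall : UniqueDiffOn ℝ (closedBall (0 : ℂ) 1) :=
  uniqueDiffOn_convex (convex_closedBall _ _) ⟨0, by simp [interior_closedBall]⟩

theorem norm_D_apply_le {f : ℂ → ℂ} {ζ : ℂ} (hζ : ‖ζ‖ = 1) : ‖D f ζ ζ‖ ≤ ‖D f ζ‖ := by
  simpa [hζ] using (D f ζ).le_opNorm ζ

/-- `z ∂f/∂z + z̄ ∂f/∂z̄` is the derivative of `f` at `z` in the radial direction. -/
theorem mul_dz_add_conj_mul_dzbar (f : ℂ → ℂ) (z : ℂ) :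
    z * dz f z + (starRingEnd ℂ) z * dzbar f z = fderiv ℝ f z z := by
  have h : fderiv ℝ f z z = z.re * fderiv ℝ f z 1 + z.im * fderiv ℝ f z Complex.I := by
    conv_lhs => rw [show z = z.re • (1 : ℂ) + z.im • Complex.I by simp [Complex.re_add_im]]
    rw [map_add, map_smul, map_smul, ← Complex.re_add_im z]
    simp
  rw [h, dz, dzbar]
  have h1 := Complex.re_add_im z
  have h2 : (starRingEnd ℂ) z = z.re - z.im * Complex.I := by
    apply Complex.ext <;> simp
  rw [h2]
  nth_rewrite 1 [← h1]
  linear_combination (-z.im * fderiv ℝ f z Complex.I) * Complex.I_sq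

theorem ofReal_mul_mem_ball {ζ : ℂ} (hζ : ‖ζ‖ = 1) {r : ℝ} (hr : r ∈ Ioo (0 : ℝ) 1) :
    (r : ℂ) * ζ ∈ ball (0 : ℂ) 1 := by
  simpa [hζ, abs_of_pos hr.1] using hr.2

theorem eventually_mem_Ioo_nhdsLT_one : ∀ᶠ r : ℝ in 𝓝[<] 1, r ∈ Ioo (0 : ℝ) 1 :=
  Ioo_mem_nhdsLT one_pos

theorem tendsto_ofReal_mul_nhdsWithin {ζ : ℂ} (hζ : ‖ζ‖ = 1) :
    Tendsto (fun r : ℝ => (r : ℂ) * ζ) (𝓝[<] 1) (𝓝[closedBall 0 1] ζ) := by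
  refine tendsto_nhdsWithin_iff.2 ⟨?_, ?_⟩
  · have h : Continuous fun r : ℝ => (r : ℂ) * ζ := by fun_prop
    simpa using (h.tendsto 1).mono_left nhdsWithin_le_nhds
  · filter_upwards [eventually_mem_Ioo_nhdsLT_one] with r hr
    exact ball_subset_closedBall (ofReal_mul_mem_ball hζ hr)

theorem closedBall_mem_nhds_of_mem_ball {z : ℂ} (hz : z ∈ ball (0 : ℂ) 1) :
    closedBall (0 : ℂ) 1 ∈ 𝓝 z :=
  mem_of_superset (isOpen_ball.mem_nhds hz) ball_subset_closedBall

theorem one_sub_sq_norm_pos {z : ℂ} (hz : z ∈ ball (0 : ℂ) 1) : 0 < 1 - ‖z‖ ^ 2 := by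
  have := mem_ball_zero_iff.1 hz
  nlinarith [norm_nonneg z]

/-- The equation `T_α f = 0` cleared of its singular weight `4 (1 - |z|²)^(-α-1)`. -/
theorem laplacian_add_radial_eq_of_T_eq_zero {α : ℝ} {f : ℂ → ℂ} {z : ℂ}
    (hz : z ∈ ball (0 : ℂ) 1) (hT : T α f z = 0) :
    ((1 - ‖z‖ ^ 2 : ℝ) : ℂ) * Laplacian.laplacian f z + (2 * α : ℝ) * fderiv ℝ f z z
      = (α ^ 2 : ℝ) * f z := by
  have hp := one_sub_sq_norm_pos hz
  set P := (1 - ‖z‖ ^ 2) ^ (-α - 1) with hP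
  have hP0 : (P : ℂ) ≠ 0 := Complex.ofReal_ne_zero.2 (Real.rpow_pos_of_pos hp _).ne'
  have hw : (1 - ‖z‖ ^ 2) ^ (-α) = P * (1 - ‖z‖ ^ 2) := by
    rw [hP, ← Real.rpow_add_one hp.ne', sub_add_cancel]
  rw [T, mul_dz_add_conj_mul_dzbar, hw, ← hP] at hT
  refine mul_left_cancel₀ hP0 ?_
  push_cast at hT ⊢
  linear_combination 4 * hT

/-- Since `(1 - |z|²) Δf` vanishes at the boundary, the equation `T_α f = 0` degenerates there
into the first order equation `2 ∂f/∂r = α f`. -/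
theorem D_apply_self_of_T_eq_zero {α : ℝ} (hα : 0 < α) {f : ℂ → ℂ}
    (hf : ContDiffOn ℝ 2 f (closedBall (0 : ℂ) 1))
    (hT : ∀ z ∈ ball (0 : ℂ) 1, T α f z = 0) {ζ : ℂ} (hζ : ‖ζ‖ = 1) :
    D f ζ ζ = (α / 2 : ℝ) * f ζ := by
  have hζm : ζ ∈ closedBall (0 : ℂ) 1 := by simp [hζ]
  have hρ := tendsto_ofReal_mul_nhdsWithin hζ
  set G : ℂ → ℂ := fun z => iteratedFDerivWithin ℝ 2 f (closedBall 0 1) z ![1, 1]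
    + iteratedFDerivWithin ℝ 2 f (closedBall 0 1) z ![Complex.I, Complex.I] with hG
  have hGc : ContinuousOn G (closedBall 0 1) := by
    have h := hf.continuousOn_iteratedFDerivWithin (m := 2) le_rfl uniqueDiffOn_closedBall
    exact (h.eval continuousOn_const).add (h.eval continuousOn_const)
  have hDc : ContinuousOn (fun z => fderivWithin ℝ f (closedBall 0 1) z z) (closedBall 0 1) :=
    (hf.continuousOn_fderivWithin uniqueDiffOn_closedBall one_le_two).clm_apply continuousOn_id
  have heq : ∀ z ∈ ball (0 : ℂ) 1, ((1 - ‖z‖ ^ 2 : ℝ) : ℂ) * G z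
      + (2 * α : ℝ) * fderivWithin ℝ f (closedBall 0 1) z z = (α ^ 2 : ℝ) * f z := by
    intro z hz
    have hn := closedBall_mem_nhds_of_mem_ball hz
    have h := laplacian_add_radial_eq_of_T_eq_zero hz (hT z hz)
    rw [InnerProductSpace.laplacian_eq_iteratedFDeriv_complexPlane] at h
    rw [hG, fderivWithin_of_mem_nhds hn]
    simp only [iteratedFDerivWithin_eq_iteratedFDeriv uniqueDiffOn_closedBall
      (hf.contDiffAt hn) (ball_subset_closedBall hz)]
    exact h
  have hL := ((((by fun_prop : Continuous fun z : ℂ => ((1 - ‖z‖ ^ 2 : ℝ) : ℂ)).continuousOn.mul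
    hGc).add (continuousOn_const (c := ((2 * α : ℝ) : ℂ)) |>.mul hDc)) ζ hζm).tendsto.comp hρ
  have hR := ((continuousOn_const (c := ((α ^ 2 : ℝ) : ℂ)) |>.mul hf.continuousOn)
    ζ hζm).tendsto.comp hρ
  have hev : ∀ᶠ r : ℝ in 𝓝[<] 1, _ = _ :=
    eventually_mem_Ioo_nhdsLT_one.mono fun r hr => heq _ (ofReal_mul_mem_ball hζ hr)
  have := tendsto_nhds_unique hL (hR.congr' (hev.mono fun r h => h.symm))
  have hα' : (α : ℂ) ≠ 0 := Complex.ofReal_ne_zero.2 hα.ne'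
  simp only [Pi.add_apply, Pi.mul_apply, hζ] at this
  rw [D]
  refine mul_left_cancel₀ (mul_ne_zero two_ne_zero hα') ?_
  push_cast at this ⊢
  linear_combination this

theorem half_le_norm_D {α : ℝ} (hα : 0 < α) {f : ℂ → ℂ}
    (hf : ContDiffOn ℝ 2 f (closedBall (0 : ℂ) 1))
    (hT : ∀ z ∈ ball (0 : ℂ) 1, T α f z = 0) {ζ : ℂ} (hζ : ‖ζ‖ = 1) (hfζ : ‖f ζ‖ = 1) :
    α / 2 ≤ ‖D f ζ‖ := by
  have h := norm_D_apply_le (f := f) hζ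
  rw [D_apply_self_of_T_eq_zero hα hf hT hζ, norm_mul, hfζ, mul_one, Complex.norm_real,
    Real.norm_of_nonneg (by positivity)] at h
  exact h

theorem harmonicOnNhd_of_T_zero_eq_zero {f : ℂ → ℂ}
    (hf : ContDiffOn ℝ 2 f (closedBall (0 : ℂ) 1))
    (hT : ∀ z ∈ ball (0 : ℂ) 1, T 0 f z = 0) :
    InnerProductSpace.HarmonicOnNhd f (ball 0 1) := by
  intro z hz
  refine ⟨hf.contDiffAt (closedBall_mem_nhds_of_mem_ball hz), ?_⟩
  filter_upwards [isOpen_ball.mem_nhds hz] with w hw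
  have h := laplacian_add_radial_eq_of_T_eq_zero hw (hT w hw)
  have hp : ((1 - ‖w‖ ^ 2 : ℝ) : ℂ) ≠ 0 :=
    Complex.ofReal_ne_zero.2 (one_sub_sq_norm_pos hw).ne'
  simpa [-Complex.ofReal_sub, hp] using h

/-- Heinz's boundary inequality: the bound `|f(z)| ≤ (4/π) arctan |z|` is an equality at
`|z| = 1`, so it passes to radial derivatives, and `(4/π) arctan` has slope `2/π` at `1`. -/
theorem two_div_pi_le_norm_D {f : ℂ → ℂ}
    (hf : ContDiffOn ℝ 2 f (closedBall (0 : ℂ) 1))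
    (hT : ∀ z ∈ ball (0 : ℂ) 1, T 0 f z = 0) (h0 : f 0 = 0)
    (hb : ∀ z ∈ ball (0 : ℂ) 1, ‖f z‖ ≤ 1) {ζ : ℂ} (hζ : ‖ζ‖ = 1) (hfζ : ‖f ζ‖ = 1) :
    2 / Real.pi ≤ ‖D f ζ‖ := by
  have hζm : ζ ∈ closedBall (0 : ℂ) 1 := by simp [hζ]
  refine le_trans ?_ (norm_D_apply_le (f := f) hζ)
  have hγ : HasDerivWithinAt (fun r : ℝ => (r : ℂ) * ζ) ζ (Ioo 0 1) 1 := by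
    simpa using ((Complex.ofRealCLM.hasDerivAt (x := (1 : ℝ))).mul_const ζ).hasDerivWithinAt
  have hfd : HasFDerivWithinAt f (D f ζ) (closedBall 0 1) (((1 : ℝ) : ℂ) * ζ) := by
    have := ((hf.differentiableOn two_ne_zero) ζ hζm).hasFDerivWithinAt
    simpa [D] using this
  have hd := hfd.comp_hasDerivWithinAt (1 : ℝ) hγ
    fun r hr => ball_subset_closedBall (ofReal_mul_mem_ball hζ hr)
  have hs1 := (hasDerivWithinAt_iff_tendsto_slope' (by simp)).1 hd
  have ha : HasDerivWithinAt (fun r : ℝ => 4 / Real.pi * Real.arctan r) (2 / Real.pi)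
      (Ioo 0 1) 1 := by
    have := ((Real.hasDerivAt_arctan 1).const_mul (4 / Real.pi)).hasDerivWithinAt (s := Ioo 0 1)
    rwa [show 4 / Real.pi * (1 / (1 + (1 : ℝ) ^ 2)) = 2 / Real.pi by ring] at this
  have hs2 := (hasDerivWithinAt_iff_tendsto_slope' (by simp)).1 ha
  have : (𝓝[Ioo 0 1] (1 : ℝ)).NeBot := by
    rw [nhdsWithin_Ioo_eq_nhdsLT one_pos]; infer_instance
  refine le_of_tendsto_of_tendsto hs2 hs1.norm ?_
  filter_upwards [self_mem_nhdsWithin] with r hr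
  have hS := norm_le_arctan_norm_of_harmonicOnNhd (harmonicOnNhd_of_T_zero_eq_zero hf hT) hb h0
    (ofReal_mul_mem_ball hζ hr)
  rw [norm_mul, hζ, mul_one, Complex.norm_real, Real.norm_of_nonneg hr.1.le] at hS
  have htri := norm_sub_norm_le (f ζ) (f (r * ζ))
  rw [slope_comm, slope_comm _ 1 r, slope_def_field, slope_def_module, norm_smul, norm_inv,
    Real.norm_of_nonneg (by linarith [hr.2] : (0 : ℝ) ≤ 1 - r), div_eq_inv_mul]
  have : (0 : ℝ) ≤ (1 - r)⁻¹ := inv_nonneg.2 (by linarith [hr.2])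
  refine mul_le_mul_of_nonneg_left ?_ this
  simp only [Function.comp_apply, Complex.ofReal_one, one_mul, Real.arctan_one]
  have h1 : 4 / Real.pi * (Real.pi / 4) = 1 := by field_simp
  linarith

/-! ### Integral means of the kernel -/

/-- `|1 - r e^{it}|²`, as a polynomial in `r` and `cos t`. -/
noncomputable def chordSq (r t : ℝ) : ℝ := 1 - 2 * r * Real.cos t + r ^ 2

theorem chordSq_eq_sub_sq_add (r t : ℝ) :
    chordSq r t = (r - Real.cos t) ^ 2 + Real.sin t ^ 2 := by
  rw [chordSq, Real.sin_sq]; ring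

theorem continuous_chordSq (r : ℝ) : Continuous (chordSq r) := by
  unfold chordSq; fun_prop

theorem sq_norm_one_sub_mul_exp (r t : ℝ) :
    ‖1 - (r : ℂ) * Complex.exp ((t : ℂ) * Complex.I)‖ ^ 2 = chordSq r t := by
  rw [Complex.sq_norm, Complex.normSq_apply, Complex.exp_mul_I, chordSq,
    ← Complex.ofReal_cos, ← Complex.ofReal_sin]
  simp only [Complex.sub_re, Complex.sub_im, Complex.one_re, Complex.one_im,
    Complex.add_re, Complex.add_im, Complex.ofReal_re, Complex.ofReal_im, Complex.mul_re,
    Complex.mul_im, Complex.I_re, Complex.I_im]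
  linear_combination r ^ 2 * Real.sin_sq_add_cos_sq t

theorem chordSq_le_four {r : ℝ} (hr : r ∈ Icc (0 : ℝ) 1) (t : ℝ) : chordSq r t ≤ 4 := by
  have := Real.neg_one_le_cos t
  rw [chordSq]
  nlinarith [hr.1, hr.2]

theorem chordSq_pos {r : ℝ} (hr : r ∈ Ioo (0 : ℝ) 1) (t : ℝ) : 0 < chordSq r t := by
  have := Real.cos_le_one t
  rw [chordSq]
  nlinarith [hr.1, hr.2, mul_pos hr.1 hr.1]

/-- A lower bound for `|1 - r e^{it}|²` that is uniform in `r`. -/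
theorem sq_div_pi_le_chordSq {r t : ℝ} (hr : r ∈ Icc (0 : ℝ) 1) (ht : t ∈ Icc (0 : ℝ) Real.pi) :
    (t / Real.pi) ^ 2 ≤ chordSq r t := by
  have hs : t / Real.pi ≤ Real.sin (t / 2) := by
    have := Real.mul_le_sin (x := t / 2) (by linarith [ht.1]) (by linarith [ht.2])
    calc t / Real.pi = 2 / Real.pi * (t / 2) := by ring
      _ ≤ _ := this
  have h0 : 0 ≤ t / Real.pi := div_nonneg ht.1 Real.pi_pos.le
  have h1 : (t / Real.pi) ^ 2 ≤ Real.sin (t / 2) ^ 2 := pow_le_pow_left₀ h0 hs 2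
  have hc : Real.cos t = 1 - 2 * Real.sin (t / 2) ^ 2 := by
    have := Real.cos_sq' (t / 2)
    have h2 := Real.cos_two_mul (t / 2)
    rw [show 2 * (t / 2) = t by ring] at h2
    linarith
  refine h1.trans ?_
  rw [chordSq, hc]
  have h3 := Real.sin_sq_le_one (t / 2)
  nlinarith [mul_nonneg (sub_nonneg.2 h3) (sq_nonneg (1 - r)), hr.1, hr.2,
    mul_nonneg (mul_nonneg hr.1 hr.1) (sq_nonneg (Real.sin (t / 2))),
    mul_nonneg hr.1 (sq_nonneg (Real.sin (t / 2)))]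

theorem rpow_le_rpow_add_rpow {x y z : ℝ} (hx : 0 < x) (hxy : x ≤ y) (hyz : y ≤ z) (p : ℝ) :
    y ^ p ≤ x ^ p + z ^ p := by
  have hy := hx.trans_le hxy
  rcases le_total 0 p with hp | hp
  · have := Real.rpow_le_rpow hy.le hyz hp
    linarith [Real.rpow_pos_of_pos hx p]
  · have := Real.rpow_le_rpow_of_nonpos hx hxy hp
    linarith [Real.rpow_pos_of_pos (hy.trans_le hyz) p]

theorem integral_zero_two_pi_eq_two_mul {h : ℝ → ℝ} (hc : Continuous h)
    (hs : ∀ t, h (2 * Real.pi - t) = h t) :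
    ∫ t in (0 : ℝ)..(2 * Real.pi), h t = 2 * ∫ t in (0 : ℝ)..Real.pi, h t := by
  have h1 := intervalIntegral.integral_comp_sub_left (a := 0) (b := Real.pi) h (2 * Real.pi)
  simp only [hs, sub_zero, show 2 * Real.pi - Real.pi = Real.pi by ring] at h1
  rw [← intervalIntegral.integral_add_adjacent_intervals (hc.intervalIntegrable 0 Real.pi)
    (hc.intervalIntegrable _ _), ← h1]
  ring

/-- The boundary action of the disk automorphism exchanging `0` and `r`, in the angle `t` and
reflected so as to map `[0, π]` to itself: the angle `φ` with
`e^{-iφ} = (r - e^{it}) / (1 - r e^{it})`. -/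
noncomputable def moebiusAngle (r t : ℝ) : ℝ :=
  Real.pi - t - 2 * Real.arctan (r * Real.sin t / (1 - r * Real.cos t))

theorem one_sub_mul_cos_pos {r : ℝ} (hr : r ∈ Ioo (0 : ℝ) 1) (t : ℝ) :
    0 < 1 - r * Real.cos t := by
  nlinarith [Real.cos_le_one t, hr.1, hr.2]

theorem hasDerivAt_moebiusAngle {r : ℝ} (hr : r ∈ Ioo (0 : ℝ) 1) (t : ℝ) :
    HasDerivAt (moebiusAngle r) (-((1 - r ^ 2) / chordSq r t)) t := by
  have hd := one_sub_mul_cos_pos hr t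
  have h1 : HasDerivAt (fun t => r * Real.sin t / (1 - r * Real.cos t)) _ t :=
    ((Real.hasDerivAt_sin t).const_mul r).div
      (((Real.hasDerivAt_cos t).const_mul r).const_sub 1) hd.ne'
  have h2 := ((hasDerivAt_id t).const_sub Real.pi).sub (h1.arctan.const_mul 2)
  refine h2.congr_deriv ?_
  have hq := (chordSq_pos hr t).ne'
  have hy : 1 + (r * Real.sin t / (1 - r * Real.cos t)) ^ 2
      = chordSq r t / (1 - r * Real.cos t) ^ 2 := by
    rw [eq_div_iff (pow_pos hd 2).ne', add_mul, ← mul_pow, div_mul_cancel₀ _ hd.ne', chordSq]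
    linear_combination r ^ 2 * Real.sin_sq_add_cos_sq t
  rw [hy]
  have hd' := hd.ne'
  field_simp
  rw [chordSq]
  linear_combination (2 * r ^ 2) * Real.sin_sq_add_cos_sq t

theorem chordSq_moebiusAngle {r : ℝ} (hr : r ∈ Ioo (0 : ℝ) 1) (t : ℝ) :
    chordSq r (moebiusAngle r t) = (1 - r ^ 2) ^ 2 / chordSq r t := by
  have hd := one_sub_mul_cos_pos hr t
  have hq := chordSq_pos hr t
  set y := r * Real.sin t / (1 - r * Real.cos t) with hy
  have hyd : y * (1 - r * Real.cos t) = r * Real.sin t := div_mul_cancel₀ _ hd.ne'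
  have hyq : (1 + y ^ 2) * (1 - r * Real.cos t) ^ 2 = chordSq r t := by
    rw [add_mul, ← mul_pow, hyd, chordSq]
    linear_combination r ^ 2 * Real.sin_sq_add_cos_sq t
  have hy1 : 0 < 1 + y ^ 2 := by positivity
  have hcos2 : Real.cos (Real.arctan y) ^ 2 = (1 + y ^ 2)⁻¹ := by
    rw [Real.cos_sq_arctan, one_div]
  have hsc : Real.sin (Real.arctan y) = y * Real.cos (Real.arctan y) := by
    rw [← Real.tan_mul_cos (Real.cos_arctan_pos y).ne', Real.tan_arctan]
  have hc : Real.cos (moebiusAngle r t)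
      = -((Real.cos t * (1 - y ^ 2) - Real.sin t * (2 * y)) / (1 + y ^ 2)) := by
    rw [moebiusAngle, sub_sub, Real.cos_pi_sub, Real.cos_add, Real.cos_two_mul, Real.sin_two_mul,
      ← hy, hsc, div_eq_mul_inv, ← hcos2]
    have : (1 + y ^ 2) * Real.cos (Real.arctan y) ^ 2 = 1 := by
      rw [hcos2, mul_inv_cancel₀ hy1.ne']
    linear_combination -Real.cos t * this
  have key : Real.cos (moebiusAngle r t) * chordSq r t
      = -(Real.cos t * (1 + r ^ 2) - 2 * r) := by
    have e : Real.cos (moebiusAngle r t) * ((1 + y ^ 2) * (1 - r * Real.cos t) ^ 2)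
        = -(Real.cos t * ((1 - r * Real.cos t) ^ 2 - (y * (1 - r * Real.cos t)) ^ 2)
          - 2 * Real.sin t * (1 - r * Real.cos t) * (y * (1 - r * Real.cos t))) := by
      rw [hc]
      field_simp
    rw [← hyq, e, hyd]
    linear_combination (2 * r - r ^ 2 * Real.cos t) * Real.sin_sq_add_cos_sq t
  rw [eq_div_iff hq.ne']
  conv_lhs => rw [chordSq]
  have : chordSq r t = 1 - 2 * r * Real.cos t + r ^ 2 := rfl
  linear_combination (-2 * r) * key + (1 + r ^ 2) * this

/-- The change of variables given by a disk automorphism exchanges the exponents `-α - 2` and `α`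
of `|1 - r e^{it}|`, and absorbs the power of `1 - r²`. -/
theorem integral_kernel_eq_integral_chordSq_rpow (α : ℝ) {r : ℝ} (hr : r ∈ Ioo (0 : ℝ) 1) :
    ∫ t in (0 : ℝ)..Real.pi, (1 - r ^ 2) ^ (α + 1) / chordSq r t ^ ((α + 2) / 2)
      = ∫ t in (0 : ℝ)..Real.pi, chordSq r t ^ (α / 2) := by
  have hg : Continuous fun t => chordSq r t ^ (α / 2) :=
    (continuous_chordSq r).rpow_const fun t => Or.inl (chordSq_pos hr t).ne'
  have hφ' : Continuous fun t => -((1 - r ^ 2) / chordSq r t) :=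
    (continuous_const.div (continuous_chordSq r) fun t => (chordSq_pos hr t).ne').neg
  have h := intervalIntegral.integral_comp_mul_deriv (a := 0) (b := Real.pi)
    (fun t _ => hasDerivAt_moebiusAngle hr t) hφ'.continuousOn hg
  have e0 : moebiusAngle r 0 = Real.pi := by simp [moebiusAngle]
  have e1 : moebiusAngle r Real.pi = 0 := by simp [moebiusAngle]
  rw [e0, e1, intervalIntegral.integral_symm 0 Real.pi] at h
  rw [← neg_inj, ← h, ← intervalIntegral.integral_neg]
  refine intervalIntegral.integral_congr fun t _ => ?_
  have hq := chordSq_pos hr t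
  have hp : 0 < 1 - r ^ 2 := by nlinarith [hr.1, hr.2]
  simp only [Function.comp_apply]
  rw [chordSq_moebiusAngle hr, Real.div_rpow (by positivity) hq.le, ← Real.rpow_natCast_mul hp.le,
    Real.rpow_add_one hp.ne', show (α + 2) / 2 = α / 2 + 1 by ring, Real.rpow_add_one hq.ne',
    show ((2 : ℕ) : ℝ) * (α / 2) = α by push_cast; ring]
  field_simp

theorem M_eq_integral_chordSq_rpow (α : ℝ) {r : ℝ} (hr : r ∈ Ioo (0 : ℝ) 1) :
    M α r = c α / Real.pi * ∫ t in (0 : ℝ)..Real.pi, chordSq r t ^ (α / 2) := by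
  have hK : ∀ t : ℝ, K α ((r : ℂ) * Complex.exp ((t : ℂ) * Complex.I))
      = c α * ((1 - r ^ 2) ^ (α + 1) / chordSq r t ^ ((α + 2) / 2)) := by
    intro t
    rw [K, norm_mul, Complex.norm_exp_ofReal_mul_I, mul_one, Complex.norm_real,
      Real.norm_of_nonneg hr.1.le, ← sq_norm_one_sub_mul_exp, ← Real.rpow_natCast_mul
      (norm_nonneg _), show ((2 : ℕ) : ℝ) * ((α + 2) / 2) = α + 2 by push_cast; ring]
  have hcont : Continuous fun t => (1 - r ^ 2) ^ (α + 1) / chordSq r t ^ ((α + 2) / 2) :=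
    continuous_const.div
      ((continuous_chordSq r).rpow_const fun t => Or.inl (chordSq_pos hr t).ne')
      fun t => (Real.rpow_pos_of_pos (chordSq_pos hr t) _).ne'
  rw [M, ← integral_kernel_eq_integral_chordSq_rpow α hr]
  simp only [hK]
  rw [intervalIntegral.integral_const_mul, integral_zero_two_pi_eq_two_mul hcont fun t => ?_]
  · field_simp
  · simp only [chordSq, Real.cos_two_pi_sub]

/-! ### Normalization at the boundary -/

theorem beta_eq_integral {u v : ℝ} (hu : 0 < u) (hv : 0 < v) :
    ProbabilityTheory.beta u v = ∫ x in Ioo (0 : ℝ) 1, x ^ (u - 1) * (1 - x) ^ (v - 1) := by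
  have h : Complex.betaIntegral u v
      = ((∫ x in (0 : ℝ)..1, x ^ (u - 1) * (1 - x) ^ (v - 1) : ℝ) : ℂ) := by
    rw [Complex.betaIntegral, ← intervalIntegral.integral_ofReal]
    refine intervalIntegral.integral_congr fun x hx => ?_
    rw [uIcc_of_le zero_le_one] at hx
    rw [Complex.ofReal_mul, Complex.ofReal_cpow hx.1, Complex.ofReal_cpow (sub_nonneg.2 hx.2)]
    push_cast
    rfl
  rw [ProbabilityTheory.beta_eq_betaIntegralReal u v hu hv, h, Complex.ofReal_re,
    intervalIntegral.integral_of_le zero_le_one, MeasureTheory.integral_Ioc_eq_integral_Ioo]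

theorem image_half_one_sub_cos :
    (fun t => (1 - Real.cos t) / 2) '' Ioo 0 Real.pi = Ioo 0 1 := by
  ext x
  constructor
  · rintro ⟨t, ht, rfl⟩
    have h1 := Real.cos_lt_cos_of_nonneg_of_le_pi le_rfl ht.2.le ht.1
    have h2 := Real.cos_lt_cos_of_nonneg_of_le_pi ht.1.le le_rfl ht.2
    rw [Real.cos_zero] at h1
    rw [Real.cos_pi] at h2
    constructor <;> simp only <;> linarith
  · intro hx
    refine ⟨Real.arccos (1 - 2 * x), ⟨Real.arccos_pos.2 (by linarith [hx.1]), ?_⟩, ?_⟩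
    · rw [← Real.arccos_neg_one]
      exact Real.arccos_lt_arccos le_rfl (by linarith [hx.2]) (by linarith [hx.1])
    · simp only
      rw [Real.cos_arccos (by linarith [hx.2]) (by linarith [hx.1])]
      ring

/-- The substitution `x = (1 - cos t) / 2` turns the mean of `|1 - e^{it}|^α` into a beta
integral. -/
theorem integral_chordSq_one_rpow {α : ℝ} (hα : 0 < α) :
    ∫ t in (0 : ℝ)..Real.pi, chordSq 1 t ^ (α / 2)
      = 2 ^ α * ProbabilityTheory.beta ((α + 1) / 2) (1 / 2) := by
  rw [beta_eq_integral (by positivity) (by norm_num), ← image_half_one_sub_cos,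
    MeasureTheory.integral_image_eq_integral_abs_deriv_smul measurableSet_Ioo
      (f' := fun t => Real.sin t / 2)
      (fun t _ => by
        have := (((Real.hasDerivAt_cos t).const_sub 1).div_const 2).hasDerivWithinAt
          (s := Ioo 0 Real.pi)
        simpa using this)
      (fun s hs t ht hst => Real.injOn_cos (Ioo_subset_Icc_self hs) (Ioo_subset_Icc_self ht)
        (by linarith)),
    intervalIntegral.integral_of_le Real.pi_pos.le, MeasureTheory.integral_Ioc_eq_integral_Ioo,
    ← MeasureTheory.integral_const_mul]
  refine MeasureTheory.setIntegral_congr_fun measurableSet_Ioo fun t ht => ?_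
  have hx : (1 - Real.cos t) / 2 ∈ Ioo (0 : ℝ) 1 :=
    image_half_one_sub_cos ▸ mem_image_of_mem _ ht
  rw [smul_eq_mul]
  set x := (1 - Real.cos t) / 2 with hxdef
  have hx1 : 0 < 1 - x := sub_pos.2 hx.2
  have hchord : chordSq 1 t = 2 ^ 2 * x := by rw [chordSq, hxdef]; ring
  have hsin : |Real.sin t / 2| = x ^ (1 / 2 : ℝ) * (1 - x) ^ (1 / 2 : ℝ) := by
    rw [← Real.mul_rpow hx.1.le hx1.le, ← Real.sqrt_eq_rpow, ← Real.sqrt_sq_eq_abs]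
    congr 1
    rw [hxdef, div_pow, Real.sin_sq]
    ring
  have e1 : x ^ (1 / 2 : ℝ) * x ^ ((α + 1) / 2 - 1) = x ^ (α / 2) := by
    rw [← Real.rpow_add hx.1]; congr 1; ring
  have e2 : (1 - x) ^ (1 / 2 : ℝ) * (1 - x) ^ ((1 / 2 : ℝ) - 1) = 1 := by
    rw [← Real.rpow_add hx1]; norm_num
  rw [hchord, hsin, Real.mul_rpow (by norm_num) hx.1.le, ← Real.rpow_natCast_mul zero_le_two,
    show ((2 : ℕ) : ℝ) * (α / 2) = α by push_cast; ring]
  rw [← e1]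
  linear_combination (-(2 ^ α * x ^ (1 / 2 : ℝ) * x ^ ((α + 1) / 2 - 1))) * e2

/-- The constant `c_α` makes the mean of `|1 - e^{it}|^α` equal to one. -/
theorem c_div_pi_mul_integral_chordSq_one {α : ℝ} (hα : 0 < α) :
    c α / Real.pi * ∫ t in (0 : ℝ)..Real.pi, chordSq 1 t ^ (α / 2) = 1 := by
  have hd := Real.Gamma_mul_Gamma_add_half ((α + 1) / 2)
  rw [show (α + 1) / 2 + 1 / 2 = α / 2 + 1 by ring, show 2 * ((α + 1) / 2) = 1 + α by ring,
    show 1 - (1 + α) = -α by ring, Real.rpow_neg zero_le_two] at hd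
  have h1 : Real.Gamma (1 + α) ≠ 0 := (Real.Gamma_pos_of_pos (by positivity)).ne'
  have h2 : Real.Gamma (α / 2 + 1) ≠ 0 := (Real.Gamma_pos_of_pos (by positivity)).ne'
  have h3 : (2 : ℝ) ^ α ≠ 0 := (Real.rpow_pos_of_pos two_pos _).ne'
  have hs : Real.sqrt Real.pi * Real.sqrt Real.pi = Real.pi := Real.mul_self_sqrt Real.pi_pos.le
  rw [integral_chordSq_one_rpow hα, c, ProbabilityTheory.beta, Real.Gamma_one_half_eq,
    show (α + 1) / 2 + 1 / 2 = α / 2 + 1 by ring]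
  have hd' : Real.Gamma ((α + 1) / 2) * Real.Gamma (α / 2 + 1) * 2 ^ α
      = Real.Gamma (1 + α) * Real.sqrt Real.pi := by
    rw [hd]; field_simp
  generalize Real.Gamma (α / 2 + 1) = A at h2 hd' ⊢
  field_simp
  linear_combination Real.sqrt Real.pi * hd' + Real.Gamma (1 + α) * hs

/-! ### The derivative of the integral means -/

/-- The derivative of `|1 - r e^{it}|^α` with respect to `r`. -/
noncomputable def radialDeriv (α r t : ℝ) : ℝ :=
  (2 * r - 2 * Real.cos t) * (α / 2) * chordSq r t ^ (α / 2 - 1)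

theorem hasDerivAt_chordSq_rpow (α : ℝ) {r : ℝ} (hr : r ∈ Ioo (0 : ℝ) 1) (t : ℝ) :
    HasDerivAt (fun r => chordSq r t ^ (α / 2)) (radialDeriv α r t) r := by
  have h : HasDerivAt (fun r => chordSq r t) (2 * r - 2 * Real.cos t) r := by
    have h1 := ((((hasDerivAt_id r).const_mul 2).mul_const (Real.cos t)).const_sub 1).add
      (hasDerivAt_pow 2 r)
    refine h1.congr_deriv ?_
    push_cast
    ring
  exact h.rpow_const (Or.inl (chordSq_pos hr t).ne')

/-- A bound for the radial derivative, uniform in `r` and integrable over `(0, π)` because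
`α - 1 > -1`. -/
theorem norm_radialDeriv_le {α : ℝ} (hα : 0 < α) {r t : ℝ} (hr : r ∈ Ioo (0 : ℝ) 1)
    (ht : t ∈ Ioc (0 : ℝ) Real.pi) :
    ‖radialDeriv α r t‖ ≤ α * (t ^ (α - 1) / Real.pi ^ (α - 1) + 4 ^ ((α - 1) / 2)) := by
  have hq := chordSq_pos hr t
  have hr' := Ioo_subset_Icc_self hr
  have hpos : 0 < t / Real.pi := div_pos ht.1 Real.pi_pos
  have h1 : |2 * r - 2 * Real.cos t| ≤ 2 * chordSq r t ^ (1 / 2 : ℝ) := by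
    rw [← mul_sub, abs_mul, abs_two, ← Real.sqrt_eq_rpow]
    refine mul_le_mul_of_nonneg_left (Real.abs_le_sqrt ?_) zero_le_two
    rw [chordSq_eq_sub_sq_add]
    linarith [sq_nonneg (Real.sin t)]
  have h2 : chordSq r t ^ ((α - 1) / 2)
      ≤ t ^ (α - 1) / Real.pi ^ (α - 1) + 4 ^ ((α - 1) / 2) := by
    have := rpow_le_rpow_add_rpow (pow_pos hpos 2)
      (sq_div_pi_le_chordSq hr' (Ioc_subset_Icc_self ht)) (chordSq_le_four hr' t) ((α - 1) / 2)
    rwa [← Real.rpow_natCast_mul hpos.le, show ((2 : ℕ) : ℝ) * ((α - 1) / 2) = α - 1 by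
      push_cast; ring, Real.div_rpow ht.1.le Real.pi_pos.le] at this
  rw [radialDeriv, norm_mul, norm_mul, Real.norm_eq_abs, Real.norm_of_nonneg (by positivity),
    Real.norm_of_nonneg (Real.rpow_pos_of_pos hq _).le]
  calc _ ≤ 2 * chordSq r t ^ (1 / 2 : ℝ) * (α / 2) * chordSq r t ^ (α / 2 - 1) := by gcongr
    _ = α * (chordSq r t ^ (1 / 2 : ℝ) * chordSq r t ^ (α / 2 - 1)) := by ring
    _ = α * chordSq r t ^ ((α - 1) / 2) := by
      rw [← Real.rpow_add hq]; congr 2; ring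
    _ ≤ _ := by gcongr

theorem intervalIntegrable_radialDeriv_bound {α : ℝ} (hα : 0 < α) :
    IntervalIntegrable
      (fun t : ℝ => α * (t ^ (α - 1) / Real.pi ^ (α - 1) + 4 ^ ((α - 1) / 2)))
      MeasureTheory.volume 0 Real.pi :=
  (((intervalIntegral.intervalIntegrable_rpow' (by linarith)).div_const _).add
    intervalIntegrable_const).const_mul _

theorem continuous_radialDeriv (α : ℝ) {r : ℝ} (hr : r ∈ Ioo (0 : ℝ) 1) :
    Continuous (radialDeriv α r) :=
  (by fun_prop : Continuous fun t => (2 * r - 2 * Real.cos t) * (α / 2)).mul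
    ((continuous_chordSq r).rpow_const fun t => Or.inl (chordSq_pos hr t).ne')

theorem hasDerivAt_M {α : ℝ} (hα : 0 < α) {r : ℝ} (hr : r ∈ Ioo (0 : ℝ) 1) :
    HasDerivAt (M α) (c α / Real.pi * ∫ t in (0 : ℝ)..Real.pi, radialDeriv α r t) r := by
  have hcont : ∀ s ∈ Ioo (0 : ℝ) 1, Continuous fun t => chordSq s t ^ (α / 2) := fun s hs =>
    (continuous_chordSq s).rpow_const fun t => Or.inl (chordSq_pos hs t).ne'
  have hn : Ioo (0 : ℝ) 1 ∈ 𝓝 r := isOpen_Ioo.mem_nhds hr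
  have h := intervalIntegral.hasDerivAt_integral_of_dominated_loc_of_deriv_le
    (μ := MeasureTheory.volume) (a := 0) (b := Real.pi)
    (F := fun s t => chordSq s t ^ (α / 2)) (F' := radialDeriv α) hn
    (mem_of_superset hn fun s hs => (hcont s hs).aestronglyMeasurable)
    ((hcont r hr).intervalIntegrable _ _)
    (continuous_radialDeriv α hr).aestronglyMeasurable
    (Eventually.of_forall fun t ht s hs =>
      norm_radialDeriv_le hα hs (by rwa [uIoc_of_le Real.pi_pos.le] at ht))
    (intervalIntegrable_radialDeriv_bound hα)
    (Eventually.of_forall fun t _ s hs => hasDerivAt_chordSq_rpow α hs t)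
  refine (h.2.const_mul (c α / Real.pi)).congr_of_eventuallyEq ?_
  filter_upwards [hn] with s hs using M_eq_integral_chordSq_rpow α hs

/-- At `r = 1` the radial derivative of `|1 - r e^{it}|^α` is `α / 2` times the function. -/
theorem tendsto_radialDeriv (α : ℝ) {t : ℝ} (ht : t ∈ Ioc (0 : ℝ) Real.pi) :
    Tendsto (fun r => radialDeriv α r t) (𝓝[<] 1)
      (𝓝 (α / 2 * chordSq 1 t ^ (α / 2))) := by
  have hcos : Real.cos t < 1 := by
    simpa using Real.cos_lt_cos_of_nonneg_of_le_pi le_rfl ht.2 ht.1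
  have hq : chordSq 1 t = 2 - 2 * Real.cos t := by rw [chordSq]; ring
  have hq0 : chordSq 1 t ≠ 0 := by rw [hq]; linarith
  have hc : ContinuousAt (fun r => radialDeriv α r t) 1 := by
    have h1 : ContinuousAt (fun r => chordSq r t) 1 := by unfold chordSq; fun_prop
    exact (by fun_prop : ContinuousAt (fun r => (2 * r - 2 * Real.cos t) * (α / 2)) 1).mul
      (h1.rpow_const (Or.inl hq0))
  have hv : radialDeriv α 1 t = α / 2 * chordSq 1 t ^ (α / 2) := by
    rw [radialDeriv, Real.rpow_sub_one hq0, mul_one, ← hq]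
    field_simp
  rw [← hv]
  exact hc.tendsto.mono_left nhdsWithin_le_nhds

theorem tendsto_deriv_M {α : ℝ} (hα : 0 < α) :
    Tendsto (fun r => deriv (M α) r) (𝓝[<] 1) (𝓝 (α / 2)) := by
  have h := (intervalIntegral.tendsto_integral_filter_of_dominated_convergence
    (μ := MeasureTheory.volume) (a := 0) (b := Real.pi) _
    (eventually_mem_Ioo_nhdsLT_one.mono fun r hr =>
      (continuous_radialDeriv α hr).aestronglyMeasurable)
    (eventually_mem_Ioo_nhdsLT_one.mono fun r hr => Eventually.of_forall fun t ht =>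
      norm_radialDeriv_le hα hr (by rwa [uIoc_of_le Real.pi_pos.le] at ht))
    (intervalIntegrable_radialDeriv_bound hα)
    (Eventually.of_forall fun t ht =>
      tendsto_radialDeriv α (by rwa [uIoc_of_le Real.pi_pos.le] at ht))).const_mul (c α / Real.pi)
  rw [intervalIntegral.integral_const_mul, mul_left_comm, c_div_pi_mul_integral_chordSq_one hα,
    mul_one] at h
  exact h.congr' (eventually_mem_Ioo_nhdsLT_one.mono fun r hr => (hasDerivAt_M hα hr).deriv.symm)

end HeinzType

theorem theorem2 (α : ℝ) (hα : 0 ≤ α) :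
    (0 < α →
      (∀ r ∈ Ioo (0 : ℝ) 1, DifferentiableAt ℝ (HeinzType.M α) r) ∧
      Tendsto (fun r : ℝ => deriv (HeinzType.M α) r) (𝓝[<] (1 : ℝ)) (𝓝 (α / 2))) ∧
    ∀ f : ℂ → ℂ,
      ContDiffOn ℝ 2 f (closedBall (0 : ℂ) 1) →
      (∀ z ∈ ball (0 : ℂ) 1, HeinzType.T α f z = 0) →
      f 0 = 0 →
      f '' closedBall (0 : ℂ) 1 = closedBall (0 : ℂ) 1 →
      f '' sphere (0 : ℂ) 1 = sphere (0 : ℂ) 1 →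
      (α = 0 → ∀ θ : ℝ,
        2 / Real.pi ≤ ‖HeinzType.D f (Complex.exp ((θ : ℂ) * Complex.I))‖) ∧
      (0 < α → ∀ θ : ℝ,
        α / 2 ≤ ‖HeinzType.D f (Complex.exp ((θ : ℂ) * Complex.I))‖) := by
  refine ⟨fun h => ⟨fun r hr => (HeinzType.hasDerivAt_M h hr).differentiableAt,
    HeinzType.tendsto_deriv_M h⟩, fun f hf hT h0 hball hsphere => ?_⟩
  have hζ : ∀ θ : ℝ, ‖Complex.exp ((θ : ℂ) * Complex.I)‖ = 1 := Complex.norm_exp_ofReal_mul_I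
  have hfζ : ∀ θ : ℝ, ‖f (Complex.exp ((θ : ℂ) * Complex.I))‖ = 1 := fun θ =>
    mem_sphere_zero_iff_norm.1
      (hsphere ▸ mem_image_of_mem f (mem_sphere_zero_iff_norm.2 (hζ θ)))
  have hb : ∀ z ∈ ball (0 : ℂ) 1, ‖f z‖ ≤ 1 := fun z hz =>
    mem_closedBall_zero_iff.1 (hball ▸ mem_image_of_mem f (ball_subset_closedBall hz))
  refine ⟨?_, fun h θ => HeinzType.half_le_norm_D h hf hT (hζ θ) (hfζ θ)⟩
  rintro rfl θ
  exact HeinzType.two_div_pi_le_norm_D hf hT h0 hb (hζ θ) (hfζ θ)
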